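/- **Theorem 3.5.** Let $(\mathcal A_n)_{n\ge 0}$ be finite alphabets with $\sup_n|\mathcal A_n|<\infty$, let $(q_n)_{n\ge0}$ be positive integers, and let $\boldsymbol\theta=(\theta^{(n)})_{n\ge 0}$ be a constant-length directive sequence with length sequence $(q_n)$, i.e. morphisms $\theta^{(n)}\colon \mathcal A_{n+1}\to\mathcal A_n^{q_n}$, extended by concatenation to finite words and to two-sided sequences (the image of $x_0$ starting at position $0$). Let $X^{(n)}\subseteq\mathcal A_n^{\mathbb Z}$ be the set of two-sided sequences all of whose finite subwords occur in some $\theta^{(n)}\circ\cdots\circ\theta^{(N-1)}(a)$ with $N>n$, $a\in\mathcal A_N$; let $\sigma$ be the left shift and $X_{\boldsymbol\theta}=X^{(0)}$. Here $\mathcal A_n^{\mathbb Z}$ carries the product of the discrete topologies. Suppose that $\boldsymbol\theta$ is torsion-free, that is: $q_n>1$ for infinitely many $n$; each $(X^{(n)},\sigma)$ is minimal (nonempty, with no nonempty proper closed $\sigma$-invariant subset); $X_{\boldsymbol\theta}$ contains no $\sigma$-periodic point; and every prime that divides some $q_k$ divides $q_n$ for infinitely many $n$. Then $\boldsymbol\theta$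 is quasi-recognizable: there is a factor map (a continuous surjection $\pi$ with $\pi\circ\sigma=\pi+1$) from $(X_{\boldsymbol\theta},\sigma)$ onto the odometer $(\mathbb Z_{(q_n)},+1)$, where $\mathbb Z_{(q_n)}=\varprojlim_n \mathbb Z/(q_0\cdots q_{n-1})\mathbb Z$ (equivalently $\prod_n\mathbb Z/q_n\mathbb Z$ with addition with carry). Moreover $\pi$ can be chosen so that $\pi(u)=0$ for every limit word $u$, i.e. for every $u\in X_{\boldsymbol\theta}$ for which there are $u^{(n)}\in X^{(n)}$ with $u^{(0)}=u$ and $\theta^{(n)}(u^{(n+1)})=u^{(n)}$ for all $n\ge0$. -/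

import Mathlib

open Filter Topology

universe u

/-- The left shift on two-sided sequences. -/
def shift {B : Type u} (x : ℤ → B) : ℤ → B := fun i => x (i + 1)

/-- The word `x_{[k, k+m)}` of length `m` that occurs in the two-sided sequence `x` at `k`. -/
def subword {B : Type u} (x : ℤ → B) (k : ℤ) (m : ℕ) : List B :=
  List.ofFn fun i : Fin m => x (k + (i : ℕ))

/-- A nonempty set of two-sided sequences is minimal (for the shift) if its only nonempty closed
shift-invariant subset is the whole set. -/
def IsMinimalShift {B : Type u} [TopologicalSpace B] (X : Set (ℤ → B)) : Prop :=
  X.Nonempty ∧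
    ∀ Y : Set (ℤ → B), Y ⊆ X → Y.Nonempty → IsClosed Y → shift '' Y = Y → Y = X

/-- A set of two-sided sequences is aperiodic if it has no shift-periodic point. -/
def IsAperiodicShift {B : Type u} (X : Set (ℤ → B)) : Prop :=
  ∀ x ∈ X, ∀ k : ℕ, 1 ≤ k → shift^[k] x ≠ x

/-- A directive sequence of constant-length morphisms `A (n+1) → (A n)⁺` with length sequence `q`:
the image of a letter `a` under the `n`-th morphism is the nonempty word
`morphism n a 0, …, morphism n a (q n - 1)`. -/
structure DirectiveSequence (A : ℕ → Type u) (q : ℕ → ℕ) where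
  morphism : ∀ n, A (n + 1) → Fin (q n) → A n
  length_pos : ∀ n, 0 < q n

namespace DirectiveSequence

variable {A : ℕ → Type u} {q : ℕ → ℕ} (θ : DirectiveSequence A q)

/-- The `n`-th morphism acting on finite words by concatenation. -/
def onWords (n : ℕ) (w : List (A (n + 1))) : List (A n) :=
  w.flatMap fun a => List.ofFn (θ.morphism n a)

/-- The `n`-th morphism acting on two-sided sequences by concatenation: the image of the letter
`x k` occupies the positions `k * q n, …, k * q n + q n - 1`. -/
def onSeq (n : ℕ) (x : ℤ → A (n + 1)) : ℤ → A n := fun i =>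
  θ.morphism n (x (i / (q n : ℤ)))
    ⟨(i % (q n : ℤ)).toNat, by
      have h : (0 : ℤ) < (q n : ℤ) := by exact_mod_cast θ.length_pos n
      have h1 := Int.emod_nonneg i h.ne'
      have h2 := Int.emod_lt_of_pos i h
      omega⟩

/-- The composition `θ^{[n, n+m)}` of the morphisms with indices `n, …, n + m - 1`, on words. -/
def comp (n : ℕ) : ∀ m : ℕ, List (A (n + m)) → List (A n)
  | 0 => fun w => w
  | m + 1 => fun w => comp n m (θ.onWords (n + m) w)

/-- The words that occur in `θ^{[n, N)}(a)` for some letter `a ∈ A N` and some `N > n`. -/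
def language (n : ℕ) : Set (List (A n)) :=
  {w | ∃ m : ℕ, 1 ≤ m ∧ ∃ a : A (n + m), w <:+: θ.comp n m [a]}

/-- The two-sided level-`n` shift: all sequences whose finite subwords lie in `language n`.
The shift generated by the directive sequence is `levelShift 0`. -/
def levelShift (n : ℕ) : Set (ℤ → A n) :=
  {x | ∀ (k : ℤ) (m : ℕ), subword x k m ∈ θ.language n}

theorem shift_mem_levelShift {n : ℕ} {x : ℤ → A n} (hx : x ∈ θ.levelShift n) :
    shift x ∈ θ.levelShift n := by
  intro k m
  have h : subword (shift x) k m = subword x (k + 1) m := by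
    unfold subword shift
    congr 1
    funext i
    congr 1
    ring
  rw [h]
  exact hx (k + 1) m

/-- The shift map as a self-map of the level-`n` shift. -/
def levelShiftMap (n : ℕ) (x : θ.levelShift n) : θ.levelShift n :=
  ⟨shift x.1, θ.shift_mem_levelShift x.2⟩

/-- A point `u` of the generated shift is a (two-sided) limit word if there are
points `u⁽ⁿ⁾` of the level shifts with `u⁽⁰⁾ = u` and `θ⁽ⁿ⁾(u⁽ⁿ⁺¹⁾) = u⁽ⁿ⁾` for all `n`. -/
def IsLimitWord (u : θ.levelShift 0) : Prop :=
  ∃ U : ∀ n, ℤ → A n, U 0 = u.1 ∧ ∀ n, U n ∈ θ.levelShift n ∧ θ.onSeq n (U (n + 1)) = U n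

/-- Torsion-free directive sequences. -/
structure IsTorsionFree [∀ n, TopologicalSpace (A n)] : Prop where
  length_gt_one : ∃ᶠ n in atTop, 1 < q n
  minimal : ∀ n, IsMinimalShift (θ.levelShift n)
  aperiodic : IsAperiodicShift (θ.levelShift 0)
  prime_dvd : ∀ p : ℕ, p.Prime → (∃ k, p ∣ q k) → ∃ᶠ n in atTop, p ∣ q n

end DirectiveSequence

/-- The products `q 0 * ⋯ * q (n - 1)`. -/
def lengthProd (q : ℕ → ℕ) (n : ℕ) : ℕ := ∏ i ∈ Finset.range n, q i

theorem lengthProd_dvd_succ (q : ℕ → ℕ) (n : ℕ) : lengthProd q n ∣ lengthProd q (n + 1) := by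
  unfold lengthProd
  rw [Finset.prod_range_succ]
  exact Dvd.intro _ rfl

/-- The inverse limit of the rings `ℤ / (q 0 ⋯ q (n-1)) ℤ` along the reduction maps, with the
topology induced by the product of the discrete topologies. As a topological group
this is the product of the `ℤ / q n ℤ` with addition with carry, and `1` is the image
of the integer `1`. -/
def Odometer (q : ℕ → ℕ) : Subring (∀ n, ZMod (lengthProd q n)) where
  carrier := {z | ∀ n, ZMod.castHom (lengthProd_dvd_succ q n) (ZMod (lengthProd q n)) (z (n + 1))
    = z n}
  mul_mem' ha hb n := by rw [Pi.mul_apply, map_mul, ha n, hb n, Pi.mul_apply]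
  one_mem' n := by rw [Pi.one_apply, map_one, Pi.one_apply]
  add_mem' ha hb n := by rw [Pi.add_apply, map_add, ha n, hb n, Pi.add_apply]
  zero_mem' n := by rw [Pi.zero_apply, map_zero, Pi.zero_apply]
  neg_mem' ha n := by rw [Pi.neg_apply, map_neg, ha n, Pi.neg_apply]

/-- `π` is a factor map of topological dynamical systems from `(X, S)` onto `(Z, T)`. -/
structure IsFactorMap {X Z : Type*} [TopologicalSpace X] [TopologicalSpace Z]
    (S : X → X) (T : Z → Z) (π : X → Z) : Prop where
  continuous : Continuous π
  surjective : Function.Surjective π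
  semiconj : ∀ x, π (S x) = T (π x)

namespace DirectiveSequence

variable {A : ℕ → Type u} {q : ℕ → ℕ} [∀ n, TopologicalSpace (A n)] (θ : DirectiveSequence A q)

/-- `π` is a tiling factor map: a factor map from the shift generated by the directive sequence
onto the odometer with rotation `z ↦ z + 1` (which is an equicontinuous system). -/
def IsTilingFactorMap (π : θ.levelShift 0 → Odometer q) : Prop :=
  IsFactorMap (θ.levelShiftMap 0) (fun z : Odometer q => z + 1) π

/-- Quasi-recognizability: all level shifts are minimal and there is a tiling factor map. -/
def IsQuasiRecognizable : Prop :=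
  (∀ n, IsMinimalShift (θ.levelShift n)) ∧
    ∃ π : θ.levelShift 0 → Odometer q, θ.IsTilingFactorMap π

end DirectiveSequence

/-! Write Q_n for `lengthProd q n` and T for the shift. The set `tower n` = θ^{[0,n)}(X⁽ⁿ⁾) is
closed, minimal for T^{Q_n}, and its translates cover X. Without recognizability these translates
may coincide: by minimality the k with T^k(`tower n`) ⊆ `tower n` form a group dℤ containing Q_n, so
only the position modulo d is well defined.

The loss h = Q_m / d is bounded. A point of `tower m`, cut into words of length d, is a sequence in
which any h consecutive words form the image of a single letter of A_m. If h ≥ |A_m|, Morse–Hedlund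
makes the point periodic, against aperiodicity; hence h < |A_m| ≤ K (`lt_card_of_mem_towerPeriods`).
Since every prime occurring in the lengths occurs infinitely often, a bounded factor cannot prevent
Q_n from dividing d once m is large (`exists_lengthProd_dvd_of_bounded`).

So for such m the position of x relative to `tower m` is well defined modulo Q_n, and these residues
form the point π(x) of the odometer. Limit words lie in every tower, at position 0. -/

/-- The translation of a two-sided sequence by the integer `k`, i.e. the `k`-th power of the
shift. -/
def shiftBy {B : Type u} (k : ℤ) (x : ℤ → B) : ℤ → B := fun i => x (i + k)

/-! ### Integer powers of the shift. -/

section ShiftBy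

variable {B : Type u}

theorem shiftBy_apply (k : ℤ) (x : ℤ → B) (i : ℤ) : shiftBy k x i = x (i + k) := rfl

theorem shiftBy_zero (x : ℤ → B) : shiftBy 0 x = x := by
  funext i; simp [shiftBy]

theorem shiftBy_shiftBy (k l : ℤ) (x : ℤ → B) :
    shiftBy k (shiftBy l x) = shiftBy (k + l) x := by
  funext i; simp [shiftBy, add_assoc]

theorem shiftBy_one (x : ℤ → B) : shiftBy 1 x = shift x := rfl

theorem shift_iterate (k : ℕ) (x : ℤ → B) : shift^[k] x = shiftBy k x := by
  induction k with
  | zero => simp [shiftBy_zero]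
  | succ k ih =>
    rw [Function.iterate_succ_apply', ih, ← shiftBy_one, shiftBy_shiftBy]
    congr 1; push_cast; ring

theorem subword_shiftBy (k l : ℤ) (m : ℕ) (x : ℤ → B) :
    subword (shiftBy k x) l m = subword x (l + k) m := by
  unfold subword shiftBy
  congr 1; funext i; congr 1; ring

theorem continuous_shiftBy [TopologicalSpace B] (k : ℤ) :
    Continuous (shiftBy k : (ℤ → B) → ℤ → B) :=
  continuous_pi fun i => continuous_apply (i + k)

theorem shift_image_eq_of_shiftBy_mem {Y : Set (ℤ → B)} (h : ∀ x ∈ Y, shiftBy 1 x ∈ Y)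
    (h' : ∀ x ∈ Y, shiftBy (-1) x ∈ Y) : shift '' Y = Y := by
  apply Set.Subset.antisymm
  · rintro _ ⟨x, hx, rfl⟩
    exact h x hx
  · intro x hx
    refine ⟨shiftBy (-1) x, h' x hx, ?_⟩
    rw [← shiftBy_one, shiftBy_shiftBy]
    simp [shiftBy_zero]

end ShiftBy

/-! ### The Morse–Hedlund theorem. -/

section MorseHedlund

variable {B : Type*}

/-- A two-sided sequence over a finite set in which every term determines the next one is
periodic. -/
theorem exists_period_of_determines_next [Finite B] (w : ℤ → B)
    (h : ∀ i j, w i = w j → w (i + 1) = w (j + 1)) :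
    ∃ k : ℕ, 1 ≤ k ∧ ∀ i, w (i + k) = w i := by
  choose r hr using fun b : Set.range w => b.2
  let φ : Set.range w → Set.range w := fun b => ⟨w (r b + 1), Set.mem_range_self _⟩
  have hφ : ∀ i, φ ⟨w i, Set.mem_range_self i⟩ = ⟨w (i + 1), Set.mem_range_self _⟩ := fun i =>
    Subtype.ext (h _ _ (hr _))
  -- The successor map is onto a finite set, hence injective: terms also determine their
  -- predecessors, so one repetition propagates in both directions.
  have hsurj : Function.Surjective φ := by
    rintro ⟨_, i, rfl⟩
    refine ⟨⟨w (i - 1), Set.mem_range_self _⟩, ?_⟩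
    rw [hφ]
    simp
  have hinj : Function.Injective φ := Finite.injective_iff_surjective.2 hsurj
  have hback : ∀ i j, w (i + 1) = w (j + 1) → w i = w j := by
    intro i j hij
    have : φ ⟨w i, Set.mem_range_self i⟩ = φ ⟨w j, Set.mem_range_self j⟩ := by
      rw [hφ, hφ]; exact Subtype.ext hij
    exact congrArg Subtype.val (hinj this)
  obtain ⟨a, b, hab, heq⟩ := Finite.exists_ne_map_eq_of_infinite fun n : ℕ => w n
  wlog hlt : a < b generalizing a b
  · exact this b a hab.symm heq.symm (lt_of_le_of_ne (not_lt.1 hlt) hab.symm)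
  refine ⟨b - a, by omega, fun i => ?_⟩
  have key : ∀ n : ℤ, w (a + n) = w (b + n) := by
    intro n
    induction n using Int.induction_on with
    | zero => simpa using heq
    | succ n ih => simpa [add_assoc] using h _ _ ih
    | pred n ih =>
      apply hback
      have e : ∀ c : ℤ, c + (-(n : ℤ) - 1) + 1 = c + -n := fun c => by ring
      rw [e, e]; exact ih
  have := key (i - a)
  rw [Nat.cast_sub hlt.le]
  rw [show (a : ℤ) + (i - a) = i by ring] at this
  rw [this]
  congr 1; ring

/-- The Morse–Hedlund theorem for two-sided sequences: if the words of length `h` in `z` are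
determined by a code with at most `h` values, then `z` is periodic. -/
theorem exists_period_of_card_le [Finite B] {C : Type*} [Finite C] (z : ℤ → B) (h : ℕ)
    (c : ℤ → C) (hc : ∀ i j, c i = c j → ∀ t : ℕ, t < h → z (i + t) = z (j + t))
    (hcard : Nat.card C ≤ h) :
    ∃ k : ℕ, 1 ≤ k ∧ ∀ i, z (i + k) = z i := by
  let w : ∀ t : ℕ, ℤ → Fin t → B := fun t i s => z (i + (s : ℕ))
  let p : ℕ → ℕ := fun t => Nat.card (Set.range (w t))
  let ρ : ∀ t, Set.range (w (t + 1)) → Set.range (w t) := fun t b =>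
    ⟨fun s => b.1 s.castSucc, by
      obtain ⟨_, i, rfl⟩ := b
      exact ⟨i, rfl⟩⟩
  have hρ : ∀ t, Function.Surjective (ρ t) := by
    rintro t ⟨_, i, rfl⟩
    exact ⟨⟨w (t + 1) i, i, rfl⟩, rfl⟩
  have hp : p h ≤ h := by
    refine le_trans ?_ hcard
    choose r hr using fun b : Set.range (w h) => b.2
    refine Nat.card_le_card_of_injective (fun b => c (r b)) fun b b' hbb => ?_
    apply Subtype.ext
    rw [← hr b, ← hr b']
    funext s
    exact hc _ _ hbb s s.2
  -- The complexity `p` starts at 1 or more and is at most `h` at length `h`, so it cannot increase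
  -- at each of the `h` steps. Where it stalls, words of length `t` extend uniquely to the right.
  have hex : ∃ t, t < h ∧ p (t + 1) ≤ p t := by
    by_contra! hcon
    have : ∀ t, t ≤ h → t + 1 ≤ p t := by
      intro t
      induction t with
      | zero =>
        intro _
        have : Nonempty (Set.range (w 0)) := ⟨⟨w 0 0, 0, rfl⟩⟩
        exact Nat.card_pos
      | succ t ih =>
        intro ht
        have h1 := ih (by omega)
        have h2 := hcon t (by omega)
        omega
    have := this h le_rfl
    omega
  obtain ⟨t, -, hpt⟩ := hex
  have hinj : Function.Injective (ρ t) :=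
    ((Nat.bijective_iff_surjective_and_card (ρ t)).2
      ⟨hρ t, le_antisymm hpt (Nat.card_le_card_of_surjective _ (hρ t))⟩).1
  have hnext : ∀ i j, w t i = w t j → w (t + 1) i = w (t + 1) j := by
    intro i j hij
    have : ρ t ⟨w (t + 1) i, i, rfl⟩ = ρ t ⟨w (t + 1) j, j, rfl⟩ := Subtype.ext hij
    exact congrArg Subtype.val (hinj this)
  obtain ⟨k, hk, hper⟩ := exists_period_of_determines_next (w t) (by
    intro i j hij
    funext s
    have := congrFun (hnext i j hij) s.succ
    simpa [w, add_assoc, add_comm (1 : ℤ)] using this)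
  refine ⟨k, hk, fun i => ?_⟩
  have := congrFun (hnext _ _ (hper (i - t))) (Fin.last t)
  simp only [w, Fin.val_last] at this
  rw [show i - (t : ℤ) + k + t = i + k by ring, show i - (t : ℤ) + t = i by ring] at this
  exact this

end MorseHedlund

/-! ### Divisibility of the products of lengths. -/

section LengthProd

variable {q : ℕ → ℕ}

theorem lengthProd_succ (q : ℕ → ℕ) (n : ℕ) : lengthProd q (n + 1) = lengthProd q n * q n :=
  Finset.prod_range_succ _ _

theorem lengthProd_dvd_of_le (q : ℕ → ℕ) {m n : ℕ} (h : m ≤ n) :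
    lengthProd q m ∣ lengthProd q n :=
  Finset.prod_dvd_prod_of_subset _ _ _ (Finset.range_mono h)

theorem lengthProd_pos (hq : ∀ n, 0 < q n) (n : ℕ) : 0 < lengthProd q n :=
  Finset.prod_pos fun i _ => hq i

theorem exists_prime_pow_dvd_lengthProd {p : ℕ} (hp : ∃ᶠ n in atTop, p ∣ q n) (j : ℕ) :
    ∃ m, p ^ j ∣ lengthProd q m := by
  induction j with
  | zero => exact ⟨0, by simp⟩
  | succ j ih =>
    obtain ⟨m, hm⟩ := ih
    obtain ⟨n, hn, hpn⟩ := (frequently_atTop.1 hp) m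
    refine ⟨n + 1, ?_⟩
    rw [lengthProd_succ, pow_succ]
    exact mul_dvd_mul (hm.trans (lengthProd_dvd_of_le q hn)) hpn

/-- If every prime dividing some `q k` divides infinitely many `q n`, then every product
`q 0 ⋯ q (n - 1)` divides, for large `m`, the quotient of `q 0 ⋯ q (m - 1)` by any bounded
factor. -/
theorem exists_lengthProd_dvd_of_bounded (hq : ∀ n, 0 < q n)
    (hprime : ∀ p : ℕ, p.Prime → (∃ k, p ∣ q k) → ∃ᶠ n in atTop, p ∣ q n) (K n : ℕ) :
    ∃ m, ∀ d h : ℕ, lengthProd q m = h * d → h ≤ K → lengthProd q n ∣ d := by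
  classical
  set Q := lengthProd q n with hQ
  -- The surplus `K` pays for the factor `h`, whose `p`-adic valuation is less than `h ≤ K`.
  have hex : ∀ p : ℕ, ∃ m, p ∈ Q.primeFactors → p ^ (Q.factorization p + K) ∣ lengthProd q m := by
    intro p
    by_cases hp : p ∈ Q.primeFactors
    · have hpp := Nat.prime_of_mem_primeFactors hp
      obtain ⟨k, -, hk⟩ := (Prime.dvd_finsetProd_iff hpp.prime _).1
        (Nat.dvd_of_mem_primeFactors hp)
      obtain ⟨m, hm⟩ := exists_prime_pow_dvd_lengthProd (hprime p hpp ⟨k, hk⟩)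
        (Q.factorization p + K)
      exact ⟨m, fun _ => hm⟩
    · exact ⟨0, fun h => absurd h hp⟩
  choose M hM using hex
  refine ⟨Q.primeFactors.sup M, fun d h hdh hK => ?_⟩
  have hpos := lengthProd_pos hq (Q.primeFactors.sup M)
  have hh : h ≠ 0 := by rintro rfl; simp [hdh] at hpos
  have hd : d ≠ 0 := by rintro rfl; simp [hdh] at hpos
  rw [← Nat.factorization_le_iff_dvd (lengthProd_pos hq n).ne' hd]
  intro p
  by_cases hp : p ∈ Q.primeFactors
  · have h1 : p ^ (Q.factorization p + K) ∣ h * d :=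
      hdh ▸ (hM p hp).trans (lengthProd_dvd_of_le q (Finset.le_sup hp))
    rw [(Nat.prime_of_mem_primeFactors hp).pow_dvd_iff_le_factorization (mul_ne_zero hh hd),
      Nat.factorization_mul hh hd, Finsupp.add_apply] at h1
    have h2 := Nat.factorization_lt p hh
    rw [← hQ]
    omega
  · rw [← Nat.support_factorization, Finsupp.notMem_support_iff] at hp
    rw [← hQ, hp]
    exact Nat.zero_le _

end LengthProd

namespace DirectiveSequence

/-! ### Morphisms on words and sequences; towers. -/

section Words

variable {A : ℕ → Type u} {q : ℕ → ℕ} (θ : DirectiveSequence A q)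

theorem onWords_heq {N N' : ℕ} (h : N = N') {w : List (A (N + 1))} {w' : List (A (N' + 1))}
    (hw : w ≍ w') : θ.onWords N w ≍ θ.onWords N' w' := by
  subst h
  rw [eq_of_heq hw]

/-- `comp` unfolds at its innermost morphism, whereas here the outermost is split off; the indices
then agree only propositionally, whence `HEq`. -/
theorem onWords_comp (n m : ℕ) {w : List (A (n + 1 + m))} {w' : List (A (n + (m + 1)))}
    (hw : w ≍ w') : θ.onWords n (θ.comp (n + 1) m w) = θ.comp n (m + 1) w' := by
  induction m with
  | zero =>
    rw [eq_of_heq hw]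
    rfl
  | succ m ih => exact ih (θ.onWords_heq (by omega) hw)

theorem onWords_infix {n : ℕ} {v w : List (A (n + 1))} (h : v <:+: w) :
    θ.onWords n v <:+: θ.onWords n w := by
  obtain ⟨s, t, rfl⟩ := h
  exact ⟨θ.onWords n s, θ.onWords n t, by simp [onWords]⟩

theorem mem_language_of_infix {n : ℕ} {v w : List (A n)} (h : v <:+: w) (hw : w ∈ θ.language n) :
    v ∈ θ.language n := by
  obtain ⟨m, hm, a, ha⟩ := hw
  exact ⟨m, hm, a, h.trans ha⟩

theorem onWords_mem_language {n : ℕ} {w : List (A (n + 1))} (hw : w ∈ θ.language (n + 1)) :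
    θ.onWords n w ∈ θ.language n := by
  obtain ⟨m, hm, a, ha⟩ := hw
  have e : n + 1 + m = n + (m + 1) := by omega
  have hcast : ∃ b : A (n + (m + 1)), [a] ≍ [b] := by
    rw [← e]; exact ⟨a, HEq.rfl⟩
  obtain ⟨b, hb⟩ := hcast
  refine ⟨m + 1, by omega, b, ?_⟩
  rw [← θ.onWords_comp n m hb]
  exact θ.onWords_infix ha

theorem onSeq_apply_mul_add (n : ℕ) (x : ℤ → A (n + 1)) (k : ℤ) (t : Fin (q n)) :
    θ.onSeq n x (k * q n + (t : ℕ)) = θ.morphism n (x k) t := by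
  have hq : (0 : ℤ) < q n := by exact_mod_cast θ.length_pos n
  have ht : ((t : ℕ) : ℤ) < q n := by exact_mod_cast t.2
  have h1 : (k * q n + ((t : ℕ) : ℤ)) / (q n : ℤ) = k := by
    rw [add_comm, Int.add_mul_ediv_right _ _ hq.ne', Int.ediv_eq_zero_of_lt (by positivity) ht,
      zero_add]
  have h2 : (k * q n + ((t : ℕ) : ℤ)) % (q n : ℤ) = (t : ℕ) := by
    rw [add_comm, Int.add_mul_emod_self_right, Int.emod_eq_of_lt (by positivity) ht]
  unfold onSeq
  congr 1
  · rw [h1]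
  · apply Fin.ext
    simp [h2]

theorem onSeq_shiftBy (n : ℕ) (k : ℤ) (x : ℤ → A (n + 1)) :
    θ.onSeq n (shiftBy k x) = shiftBy (k * q n) (θ.onSeq n x) := by
  have hq : (0 : ℤ) < q n := by exact_mod_cast θ.length_pos n
  funext i
  simp only [shiftBy, onSeq]
  congr 1
  · rw [Int.add_mul_ediv_right _ _ hq.ne']
  · apply Fin.ext
    simp [Int.add_mul_emod_self_right]

theorem onWords_subword (n : ℕ) (x : ℤ → A (n + 1)) (k : ℤ) (m : ℕ) :
    θ.onWords n (subword x k m) = subword (θ.onSeq n x) (k * q n) (m * q n) := by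
  unfold onWords subword
  rw [List.ofFn_mul, List.flatMap_def, List.map_ofFn]
  congr 2
  funext i
  simp only [Function.comp_apply]
  congr 1
  funext j
  rw [← onSeq_apply_mul_add]
  congr 1
  push_cast
  ring

theorem subword_infix {B : Type u} (x : ℤ → B) (k : ℤ) (a b c : ℕ) :
    subword x (k + a) b <:+: subword x k (a + b + c) := by
  refine ⟨subword x k a, subword x (k + a + b) c, ?_⟩
  unfold subword
  rw [List.ofFn_add, List.ofFn_add]
  simp [add_assoc]

theorem onSeq_mem_levelShift {n : ℕ} {x : ℤ → A (n + 1)} (hx : x ∈ θ.levelShift (n + 1)) :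
    θ.onSeq n x ∈ θ.levelShift n := by
  intro k m
  have hq : (0 : ℤ) < q n := by exact_mod_cast θ.length_pos n
  -- The extra letter absorbs the offset of `k` inside its block.
  have hw := θ.onWords_mem_language (hx (k / q n) (m + 1))
  rw [onWords_subword] at hw
  refine θ.mem_language_of_infix ?_ hw
  have h1 := Int.emod_nonneg k hq.ne'
  have h2 := Int.emod_lt_of_pos k hq
  have h3 := Int.ediv_mul_add_emod k (q n)
  obtain ⟨a, ha⟩ := Int.eq_ofNat_of_zero_le h1
  have haq : a < q n := by omega
  have hmq : m ≤ m * q n := Nat.le_mul_of_pos_right m (θ.length_pos n)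
  obtain ⟨c, hc⟩ : ∃ c, (m + 1) * q n = a + m + c :=
    Nat.exists_eq_add_of_le (by rw [add_mul, one_mul]; omega)
  have := subword_infix (θ.onSeq n x) (k / q n * q n) a m c
  rw [hc]
  rwa [← ha, h3] at this

theorem shiftBy_mem_levelShift {n : ℕ} {x : ℤ → A n} (hx : x ∈ θ.levelShift n) (k : ℤ) :
    shiftBy k x ∈ θ.levelShift n := by
  intro l m
  rw [subword_shiftBy]
  exact hx _ _

/-- The composition `θ^{[0, n)}` on two-sided sequences. -/
def seqComp : ∀ n : ℕ, (ℤ → A n) → ℤ → A 0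
  | 0 => fun x => x
  | n + 1 => fun x => seqComp n (θ.onSeq n x)

theorem seqComp_mem_levelShift (n : ℕ) {x : ℤ → A n} (hx : x ∈ θ.levelShift n) :
    θ.seqComp n x ∈ θ.levelShift 0 := by
  induction n with
  | zero => exact hx
  | succ n ih => exact ih (θ.onSeq_mem_levelShift hx)

theorem seqComp_shiftBy (n : ℕ) (k : ℤ) (x : ℤ → A n) :
    θ.seqComp n (shiftBy k x) = shiftBy (k * lengthProd q n) (θ.seqComp n x) := by
  induction n generalizing k with
  | zero => simp [seqComp, lengthProd]
  | succ n ih =>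
    simp only [seqComp]
    rw [onSeq_shiftBy, ih, lengthProd_succ]
    congr 1; push_cast; ring

/-- The image under `θ^{[0, n)}` of the letter at position `0` occupies the positions
`0, …, lengthProd q n - 1`. -/
theorem seqComp_apply_eq (n : ℕ) {x y : ℤ → A n} (h : x 0 = y 0) {t : ℤ} (h0 : 0 ≤ t)
    (ht : t < lengthProd q n) : θ.seqComp n x t = θ.seqComp n y t := by
  induction n generalizing t with
  | zero =>
    have : t = 0 := by
      simp [lengthProd] at ht
      omega
    subst this
    exact h
  | succ n ih =>
    have hQ : (0 : ℤ) < lengthProd q n := by exact_mod_cast lengthProd_pos θ.length_pos n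
    rw [lengthProd_succ] at ht
    set s := t / lengthProd q n with hs
    have hs0 : 0 ≤ s := Int.ediv_nonneg h0 hQ.le
    have hsq : s < q n := Int.ediv_lt_of_lt_mul hQ (by rw [mul_comm]; exact_mod_cast ht)
    have hletter : θ.onSeq n x s = θ.onSeq n y s := by
      obtain ⟨r, hr⟩ := Int.eq_ofNat_of_zero_le hs0
      have hx := θ.onSeq_apply_mul_add n x 0 ⟨r, by omega⟩
      have hy := θ.onSeq_apply_mul_add n y 0 ⟨r, by omega⟩
      simp only [zero_mul, zero_add] at hx hy
      rw [hr, hx, hy, h]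
    have hdecomp : t = t % lengthProd q n + s * lengthProd q n := by
      rw [hs, add_comm]; exact (Int.ediv_mul_add_emod t _).symm
    have key := ih (x := shiftBy s (θ.onSeq n x)) (y := shiftBy s (θ.onSeq n y))
      (by simpa [shiftBy] using hletter) (Int.emod_nonneg t hQ.ne') (Int.emod_lt_of_pos t hQ)
    rw [seqComp_shiftBy, seqComp_shiftBy, shiftBy_apply, shiftBy_apply, ← hdecomp] at key
    exact key

/-- The set `θ^{[0, n)}(X⁽ⁿ⁾)`. -/
def tower (n : ℕ) : Set (ℤ → A 0) := θ.seqComp n '' θ.levelShift n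

theorem tower_subset_levelShift (n : ℕ) : θ.tower n ⊆ θ.levelShift 0 := by
  rintro _ ⟨x, hx, rfl⟩
  exact θ.seqComp_mem_levelShift n hx

theorem tower_antitone : Antitone θ.tower := by
  refine antitone_nat_of_succ_le fun n => ?_
  rintro _ ⟨x, hx, rfl⟩
  exact ⟨θ.onSeq n x, θ.onSeq_mem_levelShift hx, rfl⟩

theorem shiftBy_mul_mem_tower {n : ℕ} {x : ℤ → A 0} (hx : x ∈ θ.tower n) (k : ℤ) :
    shiftBy (k * lengthProd q n) x ∈ θ.tower n := by
  obtain ⟨y, hy, rfl⟩ := hx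
  exact ⟨shiftBy k y, θ.shiftBy_mem_levelShift hy k, θ.seqComp_shiftBy n k y⟩

theorem shiftBy_neg_emod_mem_tower {n : ℕ} {x : ℤ → A 0} {k : ℤ}
    (hx : shiftBy (-k) x ∈ θ.tower n) :
    shiftBy (-(k % lengthProd q n)) x ∈ θ.tower n := by
  have := θ.shiftBy_mul_mem_tower hx (k / lengthProd q n)
  rw [shiftBy_shiftBy] at this
  convert this using 2
  have := Int.ediv_mul_add_emod k (lengthProd q n)
  linarith

theorem IsLimitWord.mem_tower {θ : DirectiveSequence A q} {u : θ.levelShift 0}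
    (hu : θ.IsLimitWord u) (n : ℕ) : u.1 ∈ θ.tower n := by
  obtain ⟨U, hU0, hU⟩ := hu
  refine ⟨U n, (hU n).1, ?_⟩
  induction n with
  | zero => exact hU0
  | succ n ih =>
    simp only [seqComp]
    rw [(hU n).2, ih]

end Words

/-! ### Minimality of towers, their periods, and the factor map. -/

section Topology

variable {A : ℕ → Type u} {q : ℕ → ℕ} [∀ n, TopologicalSpace (A n)]
  {θ : DirectiveSequence A q}

theorem tower_nonempty (hmin : ∀ n, IsMinimalShift (θ.levelShift n)) (n : ℕ) :
    (θ.tower n).Nonempty := (hmin n).1.image _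

variable [∀ n, DiscreteTopology (A n)] (θ)

theorem isClosed_levelShift (n : ℕ) : IsClosed (θ.levelShift n) := by
  have : θ.levelShift n = ⋂ (k : ℤ) (m : ℕ),
      (fun (x : ℤ → A n) (i : Fin m) => x (k + (i : ℕ))) ⁻¹' {f | List.ofFn f ∈ θ.language n} := by
    ext x
    simp [levelShift, subword]
  rw [this]
  refine isClosed_iInter fun k => isClosed_iInter fun m => IsClosed.preimage ?_ ?_
  · exact continuous_pi fun i => continuous_apply _
  · exact isClosed_discrete _

theorem continuous_onSeq (n : ℕ) : Continuous (θ.onSeq n) :=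
  continuous_pi fun i =>
    (continuous_of_discreteTopology (f := fun a => θ.morphism n a _)).comp
      (continuous_apply (i / (q n : ℤ)))

theorem continuous_seqComp (n : ℕ) : Continuous (θ.seqComp n) := by
  induction n with
  | zero => exact continuous_id
  | succ n ih => exact ih.comp (θ.continuous_onSeq n)

variable {θ}

/-- The set `θ^{[0, n)}(X⁽ⁿ⁾)` is minimal for the `q 0 ⋯ q (n - 1)`-th power of the shift. -/
theorem eq_tower_of_shiftBy_mem (hmin : ∀ n, IsMinimalShift (θ.levelShift n)) {n : ℕ}
    {Y : Set (ℤ → A 0)} (hY : Y ⊆ θ.tower n) (hne : Y.Nonempty) (hcl : IsClosed Y)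
    (hinv : ∀ x ∈ Y, ∀ k : ℤ, shiftBy (k * lengthProd q n) x ∈ Y) : Y = θ.tower n := by
  have h := (hmin n).2 (θ.levelShift n ∩ θ.seqComp n ⁻¹' Y) Set.inter_subset_left
    (by
      obtain ⟨_, hy⟩ := hne
      obtain ⟨x, hx, rfl⟩ := hY hy
      exact ⟨x, hx, hy⟩)
    ((θ.isClosed_levelShift n).inter (hcl.preimage (θ.continuous_seqComp n)))
    (by
      have : ∀ (k : ℤ), ∀ x ∈ θ.levelShift n ∩ θ.seqComp n ⁻¹' Y,
          shiftBy k x ∈ θ.levelShift n ∩ θ.seqComp n ⁻¹' Y := by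
        rintro k x ⟨hx, hxY⟩
        refine ⟨θ.shiftBy_mem_levelShift hx k, ?_⟩
        rw [Set.mem_preimage, seqComp_shiftBy]
        exact hinv _ hxY k
      exact shift_image_eq_of_shiftBy_mem (this 1) (this (-1)))
  refine hY.antisymm ?_
  rintro _ ⟨x, hx, rfl⟩
  rw [← h] at hx
  exact hx.2

variable [∀ n, Finite (A n)]

variable (θ) in
theorem isClosed_tower (n : ℕ) : IsClosed (θ.tower n) :=
  ((θ.isClosed_levelShift n).isCompact.image (θ.continuous_seqComp n)).isClosed

/-- One return suffices: the points of the tower that return under T^k form a closed set invariant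
under the powers of T^{Q_n}, hence the whole tower once nonempty. -/
theorem shiftBy_mem_tower (hmin : ∀ n, IsMinimalShift (θ.levelShift n)) {n : ℕ}
    {x y : ℤ → A 0} {k : ℤ} (hx : x ∈ θ.tower n) (hkx : shiftBy k x ∈ θ.tower n)
    (hy : y ∈ θ.tower n) : shiftBy k y ∈ θ.tower n := by
  have h := eq_tower_of_shiftBy_mem hmin (Y := θ.tower n ∩ shiftBy k ⁻¹' θ.tower n)
    Set.inter_subset_left ⟨x, hx, hkx⟩
    ((θ.isClosed_tower n).inter ((θ.isClosed_tower n).preimage (continuous_shiftBy k)))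
    (by
      rintro z ⟨hz, hkz⟩ l
      refine ⟨θ.shiftBy_mul_mem_tower hz l, ?_⟩
      have := θ.shiftBy_mul_mem_tower hkz l
      rw [Set.mem_preimage, shiftBy_shiftBy, add_comm, ← shiftBy_shiftBy]
      exact this)
  rw [← h] at hy
  exact hy.2

/-- The group of the powers of the shift that preserve `θ^{[0, n)}(X⁽ⁿ⁾)`. -/
def towerPeriods (hmin : ∀ n, IsMinimalShift (θ.levelShift n)) (n : ℕ) : AddSubgroup ℤ where
  carrier := {k | ∀ x ∈ θ.tower n, shiftBy k x ∈ θ.tower n}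
  zero_mem' x hx := by rwa [shiftBy_zero]
  add_mem' ha hb x hx := by
    rw [← shiftBy_shiftBy]
    exact ha _ (hb _ hx)
  neg_mem' {k} hk x hx := by
    refine shiftBy_mem_tower hmin (hk x hx) ?_ hx
    rwa [shiftBy_shiftBy, neg_add_cancel, shiftBy_zero]

theorem lengthProd_mem_towerPeriods (hmin : ∀ n, IsMinimalShift (θ.levelShift n)) (n : ℕ) :
    (lengthProd q n : ℤ) ∈ towerPeriods hmin n := fun x hx => by
  simpa using θ.shiftBy_mul_mem_tower hx 1

/-- If the `d`-th power of the shift preserves `θ^{[0, m)}(X⁽ᵐ⁾)` and the shift is aperiodic, then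
the quotient of `q 0 ⋯ q (m - 1)` by `d` is smaller than the size of the alphabet `A m`. -/
theorem lt_card_of_mem_towerPeriods (hmin : ∀ n, IsMinimalShift (θ.levelShift n))
    (haper : IsAperiodicShift (θ.levelShift 0)) {m d h : ℕ}
    (hd : (d : ℤ) ∈ towerPeriods hmin m) (hdh : lengthProd q m = h * d) :
    h < Nat.card (A m) := by
  by_contra! hcard
  have hdpos : 0 < d := by
    have := lengthProd_pos θ.length_pos m
    rw [hdh] at this
    exact Nat.pos_of_mul_pos_left this
  obtain ⟨x, hx⟩ := tower_nonempty hmin m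
  have hmem : ∀ i : ℤ, shiftBy (i * d) x ∈ θ.tower m := fun i => by
    have := (towerPeriods hmin m).zsmul_mem hd i
    exact this x hx
  choose y _ hy using hmem
  -- The new letters are the words of length `d` of `x`; `h` of them starting at `i * d` fill the
  -- image of the letter `y i 0`, which serves as the code.
  obtain ⟨k, hk, hper⟩ := exists_period_of_card_le
    (fun (i : ℤ) (t : Fin d) => x (i * d + (t : ℕ))) h (fun i => y i 0)
    (by
      intro i j hij t ht
      funext s
      have hlt : (t : ℤ) * d + (s : ℕ) < lengthProd q m := by
        have hs := s.2
        have : (t + 1) * d ≤ h * d := Nat.mul_le_mul_right d ht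
        rw [hdh]
        push_cast at this ⊢
        zify at this hs
        nlinarith
      have := θ.seqComp_apply_eq m hij (by positivity) hlt
      rw [hy, hy, shiftBy_apply, shiftBy_apply] at this
      convert this using 2 <;> ring) hcard
  refine haper x (θ.tower_subset_levelShift m hx) (k * d) (Nat.mul_pos hk hdpos) ?_
  rw [shift_iterate]
  funext i
  have hd' : (0 : ℤ) < d := by exact_mod_cast hdpos
  have h0 := Int.emod_nonneg i hd'.ne'
  have h1 := Int.emod_lt_of_pos i hd'
  have h2 := Int.ediv_mul_add_emod i d
  have := congrFun (hper (i / d)) ⟨(i % d).toNat, by omega⟩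
  simp only [Int.toNat_of_nonneg h0] at this
  rw [h2] at this
  rw [shiftBy_apply, ← this]
  congr 1
  push_cast
  linear_combination -h2

theorem exists_lengthProd_dvd_towerPeriods (hθ : θ.IsTorsionFree)
    (hA : ∃ K : ℕ, ∀ n, Nat.card (A n) ≤ K) (n : ℕ) :
    ∃ m, ∀ k ∈ towerPeriods hθ.minimal m, (lengthProd q n : ℤ) ∣ k := by
  obtain ⟨K, hK⟩ := hA
  obtain ⟨m, hm⟩ := exists_lengthProd_dvd_of_bounded θ.length_pos hθ.prime_dvd K n
  refine ⟨m, ?_⟩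
  obtain ⟨a, ha⟩ := Int.subgroup_cyclic (towerPeriods hθ.minimal m)
  have hmem : ∀ k, k ∈ towerPeriods hθ.minimal m ↔ a ∣ k := fun k => by
    rw [ha, ← AddSubgroup.zmultiples_eq_closure, Int.mem_zmultiples_iff]
  have hdiv : a.natAbs ∣ lengthProd q m :=
    Int.natAbs_dvd_natAbs.2 ((hmem _).1 (lengthProd_mem_towerPeriods hθ.minimal m))
  obtain ⟨h, hh⟩ := hdiv
  rw [mul_comm] at hh
  have hlt := lt_card_of_mem_towerPeriods hθ.minimal hθ.aperiodic
    ((hmem a.natAbs).2 Int.dvd_natAbs_self) hh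
  have := hm _ _ hh (hlt.le.trans (hK m))
  intro k hk
  exact (Int.natCast_dvd.2 this).trans ((hmem k).1 hk)

/-- Translates of the tower depend only on residues modulo Q_n, so their union is finite, hence
closed, and minimality of X applies. -/
theorem setOf_shiftBy_mem_tower (hmin : ∀ n, IsMinimalShift (θ.levelShift n)) (n : ℕ) :
    {x | ∃ k : ℤ, shiftBy (-k) x ∈ θ.tower n} = θ.levelShift 0 := by
  have hQ : (0 : ℤ) < lengthProd q n := by exact_mod_cast lengthProd_pos θ.length_pos n
  refine (hmin 0).2 _ ?_ ?_ ?_ ?_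
  · rintro x ⟨k, hk⟩
    have := θ.shiftBy_mem_levelShift (θ.tower_subset_levelShift n hk) k
    rwa [shiftBy_shiftBy, add_neg_cancel, shiftBy_zero] at this
  · obtain ⟨x, hx⟩ := tower_nonempty hmin n
    exact ⟨x, 0, by rwa [neg_zero, shiftBy_zero]⟩
  · have : {x | ∃ k : ℤ, shiftBy (-k) x ∈ θ.tower n} =
        ⋃ k ∈ Set.Ico (0 : ℤ) (lengthProd q n), shiftBy (-k) ⁻¹' θ.tower n := by
      ext x
      simp only [Set.mem_ofPred_eq, Set.mem_iUnion, Set.mem_preimage, exists_prop]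
      constructor
      · rintro ⟨k, hk⟩
        exact ⟨_, ⟨Int.emod_nonneg k hQ.ne', Int.emod_lt_of_pos k hQ⟩,
          θ.shiftBy_neg_emod_mem_tower hk⟩
      · rintro ⟨k, -, hk⟩
        exact ⟨k, hk⟩
    rw [this]
    exact (Set.finite_Ico _ _).isClosed_biUnion fun k _ =>
      (θ.isClosed_tower n).preimage (continuous_shiftBy _)
  · have : ∀ l : ℤ, ∀ x ∈ {x | ∃ k : ℤ, shiftBy (-k) x ∈ θ.tower n},
        shiftBy l x ∈ {x | ∃ k : ℤ, shiftBy (-k) x ∈ θ.tower n} := by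
      rintro l x ⟨k, hk⟩
      refine ⟨k + l, ?_⟩
      rw [shiftBy_shiftBy]
      convert hk using 2
      ring
    exact shift_image_eq_of_shiftBy_mem (this 1) (this (-1))

theorem exists_shiftBy_mem_tower (hmin : ∀ n, IsMinimalShift (θ.levelShift n)) (n : ℕ)
    {x : ℤ → A 0} (hx : x ∈ θ.levelShift 0) : ∃ k : ℤ, shiftBy (-k) x ∈ θ.tower n := by
  rw [← setOf_shiftBy_mem_tower hmin n] at hx
  exact hx

/-- A map to the odometer computed from the position of a sequence relative to the sets
`θ^{[0, m)}(X⁽ᵐ⁾)` is a tiling factor map. -/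
theorem isTilingFactorMap_of_position (hmin : ∀ n, IsMinimalShift (θ.levelShift n))
    (π : θ.levelShift 0 → Odometer q)
    (hπ : ∀ n, ∃ M, ∀ m, M ≤ m → ∀ (x : θ.levelShift 0) (k : ℤ),
      shiftBy (-k) x.1 ∈ θ.tower m → (π x).1 n = (k : ZMod (lengthProd q n))) :
    θ.IsTilingFactorMap π := by
  have hcover := fun (x : θ.levelShift 0) m => exists_shiftBy_mem_tower hmin m x.2
  have hcont : ∀ n, Continuous fun x => (π x).1 n := by
    intro n
    obtain ⟨m, hm⟩ := hπ n
    specialize hm m le_rfl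
    have hQ : (0 : ℤ) < lengthProd q m := by exact_mod_cast lengthProd_pos θ.length_pos m
    rw [continuous_iff_isClosed]
    intro T _
    have : (fun x => (π x).1 n) ⁻¹' T =
        ⋃ k ∈ {k : ℤ | k ∈ Set.Ico (0 : ℤ) (lengthProd q m) ∧ (k : ZMod (lengthProd q n)) ∈ T},
          (fun x : θ.levelShift 0 => shiftBy (-k) x.1) ⁻¹' θ.tower m := by
      ext x
      simp only [Set.mem_preimage, Set.mem_iUnion, exists_prop, Set.mem_ofPred_eq]
      constructor
      · intro hx
        obtain ⟨k, hk⟩ := hcover x m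
        have hk' := θ.shiftBy_neg_emod_mem_tower hk
        refine ⟨_, ⟨⟨Int.emod_nonneg k hQ.ne', Int.emod_lt_of_pos k hQ⟩, ?_⟩, hk'⟩
        rwa [← hm x _ hk']
      · rintro ⟨k, ⟨-, hkT⟩, hk⟩
        rwa [hm x k hk]
    rw [this]
    refine Set.Finite.isClosed_biUnion ((Set.finite_Ico _ _).subset fun k hk => hk.1) fun k _ => ?_
    exact (θ.isClosed_tower m).preimage ((continuous_shiftBy _).comp continuous_subtype_val)
  have hsemi : ∀ x, π (θ.levelShiftMap 0 x) = π x + 1 := by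
    intro x
    apply Subtype.ext
    funext n
    obtain ⟨m, hm⟩ := hπ n
    obtain ⟨k, hk⟩ := hcover x m
    have h1 := hm m le_rfl x k hk
    have h2 := hm m le_rfl (θ.levelShiftMap 0 x) (k + 1) (by
      change shiftBy _ (shiftBy 1 x.1) ∈ _
      rw [shiftBy_shiftBy]
      convert hk using 2
      ring)
    rw [h2]
    change _ = (π x).1 n + 1
    rw [h1]
    push_cast
    rfl
  have hiter : ∀ (j : ℕ) (x), π ((θ.levelShiftMap 0)^[j] x) = π x + j := by
    intro j x
    induction j with
    | zero => simp
    | succ j ih => rw [Function.iterate_succ_apply', hsemi, ih]; push_cast; ring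
  refine ⟨?_, ?_, hsemi⟩
  · exact Continuous.subtype_mk (continuous_pi hcont) fun x => (π x).2
  · intro z
    have : CompactSpace (θ.levelShift 0) :=
      isCompact_iff_compactSpace.1 (θ.isClosed_levelShift 0).isCompact
    -- Compactness reduces surjectivity to one coordinate at a time, where iterating the shift
    -- reaches every residue.
    obtain ⟨x, hx⟩ := IsCompact.nonempty_iInter_of_sequence_nonempty_isCompact_isClosed
      (fun n => (fun x => (π x).1 n) ⁻¹' {z.1 n})
      (by
        intro n x hx
        have hx' : (π x).1 (n + 1) = z.1 (n + 1) := hx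
        change (π x).1 n = z.1 n
        rw [← (π x).2 n, ← z.2 n, hx'])
      (by
        intro n
        have : NeZero (lengthProd q n) := ⟨(lengthProd_pos θ.length_pos n).ne'⟩
        obtain ⟨x, hx⟩ := (hmin 0).1
        refine ⟨(θ.levelShiftMap 0)^[(z.1 n - (π ⟨x, hx⟩).1 n).val] ⟨x, hx⟩, ?_⟩
        change (π _).1 n = z.1 n
        rw [hiter]
        change (π ⟨x, hx⟩).1 n + (((_ : ℕ) : Odometer q)).1 n = _
        have : ∀ j : ℕ, ((j : Odometer q)).1 n = (j : ZMod (lengthProd q n)) := fun j => by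
          simp
        rw [this]
        simp)
      (((isClosed_discrete _).preimage (hcont 0)).isCompact)
      (fun n => (isClosed_discrete _).preimage (hcont n))
    refine ⟨x, Subtype.ext (funext fun n => ?_)⟩
    exact Set.mem_iInter.1 hx n

theorem exists_position_map (hθ : θ.IsTorsionFree) (hA : ∃ K : ℕ, ∀ n, Nat.card (A n) ≤ K) :
    ∃ π : θ.levelShift 0 → Odometer q,
      ∀ n, ∃ M, ∀ m, M ≤ m → ∀ (x : θ.levelShift 0) (k : ℤ),
        shiftBy (-k) x.1 ∈ θ.tower m → (π x).1 n = (k : ZMod (lengthProd q n)) := by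
  have hcover := fun m (x : θ.levelShift 0) => exists_shiftBy_mem_tower hθ.minimal m x.2
  choose M hM using exists_lengthProd_dvd_towerPeriods hθ hA
  choose κ hκ using hcover
  have key : ∀ n m, M n ≤ m → ∀ (x : θ.levelShift 0) (k : ℤ), shiftBy (-k) x.1 ∈ θ.tower m →
      (κ (M n) x : ZMod (lengthProd q n)) = k := by
    intro n m hm x k hk
    -- Both positions can be read in `tower (M n)`; their difference is then a period of that tower.
    have hk' := θ.tower_antitone hm hk
    have hx := hκ (M n) x
    rw [ZMod.intCast_eq_intCast_iff_dvd_sub]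
    rw [dvd_sub_comm]
    refine hM n _ fun y hy => shiftBy_mem_tower hθ.minimal hx ?_ hy
    rw [shiftBy_shiftBy]
    convert hk' using 2
    ring
  refine ⟨fun x => ⟨fun n => (κ (M n) x : ZMod (lengthProd q n)), fun n => ?_⟩,
    fun n => ⟨M n, fun m hm x k hk => key n m hm x k hk⟩⟩
  -- Read in a common deeper tower, both coordinates are residues of the same integer.
  have h1 := key n _ (le_max_left (M n) (M (n + 1))) x _ (hκ _ x)
  have h2 := key (n + 1) _ (le_max_right (M n) (M (n + 1))) x _ (hκ _ x)
  simp only [h1, h2, map_intCast]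

end Topology

end DirectiveSequence

theorem theorem3p5 {A : ℕ → Type u} [∀ n, Finite (A n)] [∀ n, TopologicalSpace (A n)]
    [∀ n, DiscreteTopology (A n)] {q : ℕ → ℕ} (θ : DirectiveSequence A q)
    (hθ : θ.IsTorsionFree) (hA : ∃ K : ℕ, ∀ n, Nat.card (A n) ≤ K) :
    θ.IsQuasiRecognizable ∧
      ∃ π : θ.levelShift 0 → Odometer q, θ.IsTilingFactorMap π ∧
        ∀ u : θ.levelShift 0, θ.IsLimitWord u → π u = 0 := by
  obtain ⟨π, hπ⟩ := DirectiveSequence.exists_position_map hθ hA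
  have hfactor := DirectiveSequence.isTilingFactorMap_of_position hθ.minimal π hπ
  refine ⟨⟨hθ.minimal, π, hfactor⟩, π, hfactor, fun u hu => Subtype.ext (funext fun n => ?_)⟩
  obtain ⟨m, hm⟩ := hπ n
  have := hm m le_rfl u 0 (by rw [neg_zero, shiftBy_zero]; exact hu.mem_tower m)
  simpa using this
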